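/- Let $(r,\theta,z)$ be cylindrical coordinates in $\mathbb R^3$, let $U\subset\{(r,z)\mid r>0\}$ be open and let $\tilde U\subset\mathbb R^3$ be the rotationally invariant open set with $\tilde U\cap\{\theta=0\}=U$. Let $(u,p)$ be an axisymmetric Gavrilov flow on $\tilde U$: $u\in C^\infty(\tilde U;\mathbb R^3)$ and $p\in C^\infty(\tilde U)$ are invariant under rotations about the $z$-axis and satisfy $$u\cdot\nabla u+\operatorname{grad}p=0,\qquad \nabla\cdot u=0,\qquad u\cdot\operatorname{grad}p=0 .$$ Assume that every isobaric surface $M_c=\{x\in\tilde U\mid p(x)=c\}$, $c\in p(\tilde U)$, is regular (i.e. $\operatorname{grad}p\neq0$ on it) and connected. Let $r=R(p,t)>0$, $z=Z(p,t)$ be an arc length parametrization of the generatrix $\Gamma_p=M_p\cap\{\theta=0\}$, where $R,Z$ are $C^\infty$ on an open set $D$ of pairs $(p,t)$, and where for each $p$ the parameter $t$ runs over an interval and the curve runs through all of $\Gamma_p$. Then $u$ is represented on $M_p$, with coordinates $(t,\theta)$, as $u=u^t(p,t)\,\partial_t+u^\theta(p,t)\,\partial_\theta$; assume that $u^t(p,t)\ne0$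 for all $(p,t)\in D$. A flow $(\tilde u,\tilde p)$ on $\tilde U$ is called equivalent to $(u,p)$ if $\tilde u=\varphi(p)u$ and $\operatorname{grad}\tilde p=\varphi(p)^2\operatorname{grad}p$ for a smooth non-vanishing function $\varphi$ on $p(\tilde U)$. Then: (1) There is a smooth positive function $d$ on $p(\tilde U)$ with $|u|^2=d(p)$ on $\tilde U$. There is an axisymmetric Gavrilov flow $(\tilde u,\tilde p)$ on $\tilde U$ equivalent to $(u,p)$ with $|\tilde u|^2=1$ and $\tilde u^t>0$ along the same generatrices. If $p(\tilde U)$ is an interval (in particular, if $U$ is connected), then $(\tilde u,\tilde p)$ can be chosen such that it satisfies all the hypotheses above together with the same parametrized generatrices, labelled by the values of $\tilde p$ instead of those of $p$. (2) Suppose that $|u|^2=1$ and $u^t>0$. Then there are smooth functions $\alpha>0$ and $b$ on $p(\tilde U)$ such that for all $(p,t)\in D$ one has $|b(p)|<R$ and $$R_t^2+Z_t^2=1,\qquad \sqrt{R^2-b^2(p)}\,\big|R_pZ_t-R_tZ_p\big|=\alpha^2(p),$$ $$\kappa R\big(R^2-b^2(p)\big)+b^2(p)Z_t=\operatorname{sgn}(J)\,\frac{R^3\sqrt{R^2-b^2(p)}}{\alpha^2(p)},\qquad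 J=R_pZ_t-R_tZ_p,$$ where $\kappa=R_tZ_{tt}-Z_tR_{tt}$ is the curvature of the plane curve $t\mapsto(R,Z)$. Here $J\ne0$, and $\operatorname{sgn}(J)=1$ when the generatrix is oriented so that its unit normal $(Z_t,-R_t)$ points in the direction of $\operatorname{grad}p$. Moreover $$u^t=\frac{\sqrt{R^2-b^2(p)}}{R},\qquad u^\theta=\frac{b(p)}{R^2}.$$ -/

import Mathlib

open scoped ContDiff

noncomputable section

/-- A Gavrilov flow on `V ⊆ ℝⁿ`: a smooth solution `(u, p)` of the steady Euler equations
`u·∇u + grad p = 0`, `∇·u = 0` whose velocity is orthogonal to the pressure gradient. -/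
structure IsGavrilovFlow {n : ℕ} (V : Set (EuclideanSpace ℝ (Fin n)))
    (u : EuclideanSpace ℝ (Fin n) → EuclideanSpace ℝ (Fin n))
    (p : EuclideanSpace ℝ (Fin n) → ℝ) : Prop where
  smooth_velocity : ContDiffOn ℝ ∞ u V
  smooth_pressure : ContDiffOn ℝ ∞ p V
  euler : ∀ x ∈ V, fderiv ℝ u x (u x) + gradient p x = 0
  incompressible : ∀ x ∈ V, ∑ i, (fderiv ℝ u x (EuclideanSpace.single i 1)) i = 0
  orthogonal : ∀ x ∈ V, inner ℝ (u x) (gradient p x) = 0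

/-- Equivalence of two flows on `V`: `u' = φ(p) u` and `grad p' = φ(p)² grad p` for a smooth
non-vanishing function `φ` of the pressure. -/
def EquivalentFlows {n : ℕ} (V : Set (EuclideanSpace ℝ (Fin n)))
    (u : EuclideanSpace ℝ (Fin n) → EuclideanSpace ℝ (Fin n))
    (p : EuclideanSpace ℝ (Fin n) → ℝ)
    (u' : EuclideanSpace ℝ (Fin n) → EuclideanSpace ℝ (Fin n))
    (p' : EuclideanSpace ℝ (Fin n) → ℝ) : Prop :=
  ∃ φ : ℝ → ℝ, ContDiffOn ℝ ∞ φ (p '' V) ∧ (∀ c ∈ p '' V, φ c ≠ 0) ∧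
    ∀ x ∈ V, u' x = φ (p x) • u x ∧ gradient p' x = φ (p x) ^ 2 • gradient p x

/-- The isobaric hypersurface `M_c = {x ∈ V | p x = c}`. -/
def isobaric {n : ℕ} (V : Set (EuclideanSpace ℝ (Fin n)))
    (p : EuclideanSpace ℝ (Fin n) → ℝ) (c : ℝ) : Set (EuclideanSpace ℝ (Fin n)) :=
  {x | x ∈ V ∧ p x = c}

/-- The point of `ℝ³` with cylindrical coordinates `(r, θ, z)`. -/
def cyl (r θ z : ℝ) : EuclideanSpace ℝ (Fin 3) :=
  !₂[r * Real.cos θ, r * Real.sin θ, z]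

/-- Rotation of `ℝ³` by the angle `τ` around the `z`-axis. -/
def rotZ (τ : ℝ) (x : EuclideanSpace ℝ (Fin 3)) : EuclideanSpace ℝ (Fin 3) :=
  !₂[Real.cos τ * x 0 - Real.sin τ * x 1, Real.sin τ * x 0 + Real.cos τ * x 1, x 2]

/-- The rotationally invariant subset of `ℝ³` determined by a subset `U` of the half-plane
`{(r, z) | r > 0}`. -/
def revolve (U : Set (ℝ × ℝ)) : Set (EuclideanSpace ℝ (Fin 3)) :=
  {x | (Real.sqrt (x 0 ^ 2 + x 1 ^ 2), x 2) ∈ U}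

/-- Invariance of the flow under rotations around the `z`-axis. -/
def IsAxisymmetric (V : Set (EuclideanSpace ℝ (Fin 3)))
    (u : EuclideanSpace ℝ (Fin 3) → EuclideanSpace ℝ (Fin 3))
    (p : EuclideanSpace ℝ (Fin 3) → ℝ) : Prop :=
  ∀ τ : ℝ, ∀ x ∈ V, u (rotZ τ x) = rotZ τ (u x) ∧ p (rotZ τ x) = p x

/-- `r = R(c,t)`, `z = Z(c,t)`, `(c,t) ∈ D`, is a smooth family of arc length parametrizations of
the generatrices `Γ_c = {(r,z) ∈ U | p = c}` of the isobaric surfaces of an axisymmetric flow. For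
each value `c` the parameter `t` runs over an open interval, possibly unbounded (all of `ℝ` when a
closed generatrix is parametrized periodically). -/
structure IsArcLengthGeneratrix (U : Set (ℝ × ℝ)) (p : EuclideanSpace ℝ (Fin 3) → ℝ)
    (D : Set (ℝ × ℝ)) (R Z : ℝ → ℝ → ℝ) : Prop where
  isOpen_domain : IsOpen D
  interval : ∀ c, IsPreconnected {t | (c, t) ∈ D}
  smooth_R : ContDiffOn ℝ ∞ (fun q : ℝ × ℝ => R q.1 q.2) D
  smooth_Z : ContDiffOn ℝ ∞ (fun q : ℝ × ℝ => Z q.1 q.2) D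
  image_eq : ∀ c, (fun t => (R c t, Z c t)) '' {t | (c, t) ∈ D} =
    {q | q ∈ U ∧ p (cyl q.1 0 q.2) = c}
  unit_speed : ∀ c t, (c, t) ∈ D → deriv (R c) t ^ 2 + deriv (Z c) t ^ 2 = 1

/-- The coordinate vector field `∂/∂t` of the surface of revolution
`(t, θ) ↦ (R(c,t) cos θ, R(c,t) sin θ, Z(c,t))`. -/
def coordT (R Z : ℝ → ℝ → ℝ) (c t θ : ℝ) : EuclideanSpace ℝ (Fin 3) :=
  deriv (fun s => cyl (R c s) θ (Z c s)) t

/-- The coordinate vector field `∂/∂θ` of the same surface. -/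
def coordTheta (R Z : ℝ → ℝ → ℝ) (c t θ : ℝ) : EuclideanSpace ℝ (Fin 3) :=
  deriv (fun s => cyl (R c t) s (Z c t)) θ

/-- The geometric coordinate `u^t`: the coefficient of `∂/∂t` in the expansion of `u` in the
orthogonal frame `∂/∂t, ∂/∂θ`, taken on the half-plane `θ = 0`. -/
def geomT (u : EuclideanSpace ℝ (Fin 3) → EuclideanSpace ℝ (Fin 3)) (R Z : ℝ → ℝ → ℝ)
    (c t : ℝ) : ℝ :=
  inner ℝ (u (cyl (R c t) 0 (Z c t))) (coordT R Z c t 0) / ‖coordT R Z c t 0‖ ^ 2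

/-- The geometric coordinate `u^θ`: the coefficient of `∂/∂θ` in the same expansion. -/
def geomTheta (u : EuclideanSpace ℝ (Fin 3) → EuclideanSpace ℝ (Fin 3)) (R Z : ℝ → ℝ → ℝ)
    (c t : ℝ) : ℝ :=
  inner ℝ (u (cyl (R c t) 0 (Z c t))) (coordTheta R Z c t 0) / ‖coordTheta R Z c t 0‖ ^ 2

/-- The Jacobian `J = R_p Z_t - R_t Z_p` of `(p,t) ↦ (R(p,t), Z(p,t))`. -/
def jacobianRZ (R Z : ℝ → ℝ → ℝ) (c t : ℝ) : ℝ :=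
  deriv (fun q => R q t) c * deriv (Z c) t - deriv (R c) t * deriv (fun q => Z q t) c

/-- The curvature `κ = R_t Z_tt - Z_t R_tt` of the unit speed plane curve
`t ↦ (R(c,t), Z(c,t))`. -/
def curvatureRZ (R Z : ℝ → ℝ → ℝ) (c t : ℝ) : ℝ :=
  deriv (R c) t * deriv (deriv (Z c)) t - deriv (Z c) t * deriv (deriv (R c)) t

/-- The standing hypotheses on an axisymmetric flow over `U` and its generatrices: it is an
axisymmetric Gavrilov flow, all isobaric surfaces are regular and connected, `(R, Z)` is an arc
length parametrization of the generatrices, and `u^t` does not vanish. -/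
structure RegularAxisymmetricFlow (U : Set (ℝ × ℝ))
    (u : EuclideanSpace ℝ (Fin 3) → EuclideanSpace ℝ (Fin 3))
    (p : EuclideanSpace ℝ (Fin 3) → ℝ) (D : Set (ℝ × ℝ)) (R Z : ℝ → ℝ → ℝ) : Prop where
  flow : IsGavrilovFlow (revolve U) u p
  axisymmetric : IsAxisymmetric (revolve U) u p
  regular : ∀ x ∈ revolve U, gradient p x ≠ 0
  connected : ∀ c ∈ p '' revolve U, IsConnected (isobaric (revolve U) p c)
  generatrix : IsArcLengthGeneratrix U p D R Z
  geomT_ne_zero : ∀ c t, (c, t) ∈ D → geomT u R Z c t ≠ 0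

end

/-! Rotational symmetry reduces everything to the half-plane `θ = 0`. There `grad p` has no angular
component and is normal to the generatrix, so `u ⊥ grad p` forces `u = v T + y e_θ`, with `T` the
unit tangent, `v = u^t` and `y` the swirl component. Write `'` for the derivative along a
generatrix. Expanding the derivative of `u` in the directions `∂_p`, `∂_t`, `∂_θ` turns the flow
equations into `v (y R)' = 0` (angular Euler equation), `(v R J)' = 0` (incompressibility, `R J`
being the volume density of `(p, t, θ)`), `v² κ + y² Z_t / R = 1 / J` (normal Euler equation), while
the tangential equation, combined with the angular one, gives `(v² + y²)' = 0`. The right side of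
the normal equation is `1 / J` because differentiating `p(R, Z) = p` in `p` gives `J · ∂p/∂n = 1`
for `n = (Z_t, -R_t)`; in particular `J ≠ 0`, with the sign of `∂p/∂n`.

Since `v ≠ 0` and each `t`-fibre is an interval, the angular momentum `b = y R`, the squared speed
`d = v² + y²` and the flux `l = v R J` are smooth functions of `p` alone. Multiplying `u` by `φ =
sgn(v) / √d` and replacing `p` by an antiderivative of `φ²` at `p` normalizes the flow. If `|u| = 1`
and `v > 0`, then `v R = √(R² - b²)`; the flux gives the first equation with `α² = |l|`, and the
normal equation multiplied by `R³` gives the second.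

The carrying lemmas are `euler_along_generatrix`, `jacobianRZ_mul_eq_one`,
`exists_contDiffOn_of_deriv_snd_eq_zero` and `smul_comp`. -/

open Set

/-! ### Partial derivatives on open subsets of the plane. -/

section PartialDerivatives

variable {D : Set (ℝ × ℝ)} {F : ℝ → ℝ → ℝ} {c t : ℝ}

theorem hasDerivAt_snd_fderiv (hD : IsOpen D)
    (hF : ContDiffOn ℝ ∞ (fun q : ℝ × ℝ => F q.1 q.2) D) (h : (c, t) ∈ D) :
    HasDerivAt (F c) (fderiv ℝ (fun q : ℝ × ℝ => F q.1 q.2) (c, t) (0, 1)) t := by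
  have h1 : HasFDerivAt (fun q : ℝ × ℝ => F q.1 q.2) _ (c, t) :=
    ((hF.contDiffAt (hD.mem_nhds h)).differentiableAt (by simp)).hasFDerivAt
  have h2 : HasDerivAt (fun s : ℝ => (c, s)) ((0 : ℝ), (1 : ℝ)) t :=
    (hasDerivAt_const t c).prodMk (hasDerivAt_id t)
  exact h1.comp_hasDerivAt t h2

theorem hasDerivAt_fst_fderiv (hD : IsOpen D)
    (hF : ContDiffOn ℝ ∞ (fun q : ℝ × ℝ => F q.1 q.2) D) (h : (c, t) ∈ D) :
    HasDerivAt (fun q => F q t) (fderiv ℝ (fun q : ℝ × ℝ => F q.1 q.2) (c, t) (1, 0)) c := by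
  have h1 : HasFDerivAt (fun q : ℝ × ℝ => F q.1 q.2) _ (c, t) :=
    ((hF.contDiffAt (hD.mem_nhds h)).differentiableAt (by simp)).hasFDerivAt
  have h2 : HasDerivAt (fun s : ℝ => (s, t)) ((1 : ℝ), (0 : ℝ)) c :=
    (hasDerivAt_id c).prodMk (hasDerivAt_const c t)
  exact h1.comp_hasDerivAt c h2

theorem hasDerivAt_snd (hD : IsOpen D)
    (hF : ContDiffOn ℝ ∞ (fun q : ℝ × ℝ => F q.1 q.2) D) (h : (c, t) ∈ D) :
    HasDerivAt (F c) (deriv (F c) t) t :=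
  (hasDerivAt_snd_fderiv hD hF h).differentiableAt.hasDerivAt

theorem hasDerivAt_fst (hD : IsOpen D)
    (hF : ContDiffOn ℝ ∞ (fun q : ℝ × ℝ => F q.1 q.2) D) (h : (c, t) ∈ D) :
    HasDerivAt (fun q => F q t) (deriv (fun q => F q t) c) c :=
  (hasDerivAt_fst_fderiv hD hF h).differentiableAt.hasDerivAt

theorem contDiffOn_fderiv_apply_const (hD : IsOpen D)
    (hF : ContDiffOn ℝ ∞ (fun q : ℝ × ℝ => F q.1 q.2) D) (v : ℝ × ℝ) :
    ContDiffOn ℝ ∞ (fun q => fderiv ℝ (fun q : ℝ × ℝ => F q.1 q.2) q v) D :=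
  (hF.fderiv_of_isOpen hD (m := ∞) le_rfl).clm_apply contDiffOn_const

theorem contDiffOn_deriv_snd (hD : IsOpen D)
    (hF : ContDiffOn ℝ ∞ (fun q : ℝ × ℝ => F q.1 q.2) D) :
    ContDiffOn ℝ ∞ (fun q : ℝ × ℝ => deriv (F q.1) q.2) D :=
  (contDiffOn_fderiv_apply_const hD hF (0, 1)).congr fun _ hq =>
    (hasDerivAt_snd_fderiv hD hF hq).deriv

theorem contDiffOn_deriv_fst (hD : IsOpen D)
    (hF : ContDiffOn ℝ ∞ (fun q : ℝ × ℝ => F q.1 q.2) D) :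
    ContDiffOn ℝ ∞ (fun q : ℝ × ℝ => deriv (fun s => F s q.2) q.1) D :=
  (contDiffOn_fderiv_apply_const hD hF (1, 0)).congr fun _ hq =>
    (hasDerivAt_fst_fderiv hD hF hq).deriv

theorem eventually_mem_snd (hD : IsOpen D) (h : (c, t) ∈ D) : ∀ᶠ s in nhds t, (c, s) ∈ D :=
  (Continuous.prodMk_right c).continuousAt.eventually_mem (hD.mem_nhds h)

theorem eventually_mem_fst (hD : IsOpen D) (h : (c, t) ∈ D) : ∀ᶠ s in nhds c, (s, t) ∈ D :=
  (Continuous.prodMk_left t).continuousAt.eventually_mem (hD.mem_nhds h)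

/-- Symmetry of the second derivative, evaluated on the two basis vectors. It lets `J_t` be
expressed by the `p`-derivatives of `R_t` and `Z_t`, which also occur in the derivative of `u`
across the isobaric surfaces. -/
theorem deriv_fst_deriv_snd_comm (hD : IsOpen D)
    (hF : ContDiffOn ℝ ∞ (fun q : ℝ × ℝ => F q.1 q.2) D) (h : (c, t) ∈ D) :
    deriv (fun s => deriv (fun q => F q s) c) t = deriv (fun q => deriv (F q) t) c := by
  set f : ℝ × ℝ → ℝ := fun q => F q.1 q.2
  have hsymm : IsSymmSndFDerivAt ℝ f (c, t) :=
    (hF.contDiffAt (hD.mem_nhds h)).isSymmSndFDerivAt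
      (by simpa using ENat.LEInfty.out)
  have hd : HasFDerivAt (fderiv ℝ f) (fderiv ℝ (fderiv ℝ f) (c, t)) (c, t) :=
    (((hF.fderiv_of_isOpen hD (m := ∞) le_rfl).contDiffAt
      (hD.mem_nhds h)).differentiableAt (by simp)).hasFDerivAt
  have hv (v : ℝ × ℝ) : HasFDerivAt (fun q => fderiv ℝ f q v)
      ((ContinuousLinearMap.apply ℝ ℝ v).comp (fderiv ℝ (fderiv ℝ f) (c, t))) (c, t) :=
    (ContinuousLinearMap.apply ℝ ℝ v).hasFDerivAt.comp (c, t) hd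
  have h1 : HasDerivAt (fun s => fderiv ℝ f (c, s) (1, 0))
      (fderiv ℝ (fderiv ℝ f) (c, t) (0, 1) (1, 0)) t :=
    (hv (1, 0)).comp_hasDerivAt t ((hasDerivAt_const t c).prodMk (hasDerivAt_id t))
  have h2 : HasDerivAt (fun q => fderiv ℝ f (q, t) (0, 1))
      (fderiv ℝ (fderiv ℝ f) (c, t) (1, 0) (0, 1)) c :=
    (hv (0, 1)).comp_hasDerivAt (f := fun q => (q, t)) c
      ((hasDerivAt_id c).prodMk (hasDerivAt_const c t))
  have e1 : (fun s => deriv (fun q => F q s) c) =ᶠ[nhds t] fun s => fderiv ℝ f (c, s) (1, 0) :=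
    (eventually_mem_snd hD h).mono fun s hs => (hasDerivAt_fst_fderiv hD hF hs).deriv
  have e2 : (fun q => deriv (F q) t) =ᶠ[nhds c] fun q => fderiv ℝ f (q, t) (0, 1) :=
    (eventually_mem_fst hD h).mono fun s hs => (hasDerivAt_snd_fderiv hD hF hs).deriv
  rw [e1.deriv_eq, e2.deriv_eq, h1.deriv, h2.deriv]
  exact hsymm _ _

/-- A smooth function on a plane open set with connected vertical fibres whose vertical
derivative vanishes is a smooth function of the first coordinate. -/
theorem exists_contDiffOn_of_deriv_snd_eq_zero (hD : IsOpen D)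
    (hconn : ∀ c, IsPreconnected {t | (c, t) ∈ D})
    (hF : ContDiffOn ℝ ∞ (fun q : ℝ × ℝ => F q.1 q.2) D)
    (hF0 : ∀ c t, (c, t) ∈ D → deriv (F c) t = 0) :
    ∃ g : ℝ → ℝ, ContDiffOn ℝ ∞ g (Prod.fst '' D) ∧ ∀ c t, (c, t) ∈ D → F c t = g c := by
  classical
  have hfib : ∀ c, IsOpen {t | (c, t) ∈ D} := fun c => hD.preimage (Continuous.prodMk_right c)
  have hconst : ∀ c t s, (c, t) ∈ D → (c, s) ∈ D → F c t = F c s := fun c t s ht hs =>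
    (hfib c).is_const_of_deriv_eq_zero (hconn c)
      (fun x hx => (hasDerivAt_snd hD hF hx).differentiableAt.differentiableWithinAt)
      (fun x hx => hF0 c x hx) ht hs
  -- The value `0` is taken only off the projection of `D` and plays no role.
  let g : ℝ → ℝ := fun c => if h : ∃ t, (c, t) ∈ D then F c h.choose else 0
  have hg : ∀ c t, (c, t) ∈ D → F c t = g c := fun c t ht => by
    have h : ∃ t, (c, t) ∈ D := ⟨t, ht⟩
    simp only [g, dif_pos h]
    exact hconst c _ _ ht h.choose_spec
  refine ⟨g, ?_, hg⟩
  rintro c ⟨⟨c, t⟩, h, rfl⟩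
  -- The choice of `t` inside `g` need not be continuous, but near `c` the function `g` agrees with
  -- the slice of `F` at one fixed `t`.
  have h1 : ContDiffAt ℝ ∞ (fun q => F q t) c :=
    (hF.contDiffAt (hD.mem_nhds h)).comp (f := fun q : ℝ => (q, t)) c
      (contDiffAt_id.prodMk contDiffAt_const)
  exact (h1.congr_of_eventuallyEq
    ((eventually_mem_fst hD h).mono fun q hq => (hg q t hq).symm)).contDiffWithinAt

end PartialDerivatives

/-! ### Antiderivatives and inverse functions on open subsets of the line. -/

section Antiderivative

/-- A smooth function on an open subset of the line has an antiderivative there. -/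
theorem exists_hasDerivAt_of_contDiffOn {S : Set ℝ} (hS : IsOpen S) {f : ℝ → ℝ}
    (hf : ContDiffOn ℝ ∞ f S) :
    ∃ G : ℝ → ℝ, ContDiffOn ℝ ∞ G S ∧ ∀ x ∈ S, HasDerivAt G (f x) x := by
  classical
  -- One base point per connected component: the integral then never leaves `S`, and the base point
  -- is locally constant in `x`.
  let base : Set ℝ → ℝ := fun I => if h : I.Nonempty then h.some else 0
  have hbase : ∀ I : Set ℝ, I.Nonempty → base I ∈ I := fun I h => by
    simp only [base, dif_pos h]; exact h.some_mem
  let G : ℝ → ℝ := fun x => ∫ s in (base (connectedComponentIn S x))..x, f s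
  have hG : ∀ x ∈ S, HasDerivAt G (f x) x := by
    intro x hx
    set I := connectedComponentIn S x with hI
    have hIo : IsOpen I := hS.connectedComponentIn
    have hxI : x ∈ I := mem_connectedComponentIn hx
    have hbI : base I ∈ I := hbase I ⟨x, hxI⟩
    have hIS : I ⊆ S := connectedComponentIn_subset S x
    have hoc : I.OrdConnected := isPreconnected_connectedComponentIn.ordConnected
    have hcont : ContinuousOn f I := hf.continuousOn.mono hIS
    have h1 : HasDerivAt (fun y => ∫ s in (base I)..y, f s) (f x) x := by
      apply intervalIntegral.integral_hasDerivAt_right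
      · exact (hcont.mono (hoc.uIcc_subset hbI hxI)).intervalIntegrable
      · exact hcont.stronglyMeasurableAtFilter hIo x hxI
      · exact hcont.continuousAt (hIo.mem_nhds hxI)
    refine h1.congr_of_eventuallyEq ?_
    filter_upwards [hIo.mem_nhds hxI] with y hy
    simp only [G]
    rw [← connectedComponentIn_eq hy]
  refine ⟨G, ?_, hG⟩
  rw [contDiffOn_infty_iff_deriv_of_isOpen hS]
  exact ⟨fun x hx => (hG x hx).differentiableAt.differentiableWithinAt,
    hf.congr fun x hx => (hG x hx).deriv⟩

/-- An injective smooth function with non-vanishing derivative on an open subset of the line has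
a smooth inverse on its open image. -/
theorem isOpen_image_and_contDiffOn_invFunOn {S : Set ℝ} (hS : IsOpen S) {G g : ℝ → ℝ}
    (hG : ContDiffOn ℝ ∞ G S) (hg : ∀ x ∈ S, HasDerivAt G (g x) x) (hg0 : ∀ x ∈ S, g x ≠ 0)
    (hinj : InjOn G S) :
    IsOpen (G '' S) ∧ ContDiffOn ℝ ∞ (Function.invFunOn G S) (G '' S) := by
  have key : ∀ x ∈ S, G '' S ∈ nhds (G x) ∧ ContDiffAt ℝ ∞ (Function.invFunOn G S) (G x) := by
    intro x hx
    have hc : ContDiffAt ℝ ∞ G x := hG.contDiffAt (hS.mem_nhds hx)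
    have hd : HasFDerivAt G ((ContinuousLinearEquiv.unitsEquivAut ℝ (Units.mk0 (g x) (hg0 x hx)) :
        ℝ ≃L[ℝ] ℝ) : ℝ →L[ℝ] ℝ) x := by
      have := (hg x hx).hasFDerivAt
      convert! this using 1
    let e := hc.toOpenPartialHomeomorph G hd (by simp)
    have hxs : x ∈ e.source := hc.mem_toOpenPartialHomeomorph_source hd (by simp)
    have hsymm : ContDiffAt ℝ ∞ e.symm (G x) := hc.to_localInverse hd (by simp)
    have hex : e.symm (G x) = x := e.left_inv hxs
    -- Near `G x` the local inverse takes values in `S`, so by injectivity it agrees with the global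
    -- inverse, which inherits its smoothness.
    have hev : ∀ᶠ y in nhds (G x), e.symm y ∈ S ∧ G (e.symm y) = y := by
      have h1 : ∀ᶠ y in nhds (G x), e.symm y ∈ S :=
        hsymm.continuousAt.eventually_mem (by rw [hex]; exact hS.mem_nhds hx)
      have h2 : ∀ᶠ y in nhds (G x), y ∈ e.target :=
        e.open_target.mem_nhds (e.map_source hxs)
      filter_upwards [h1, h2] with y hy1 hy2
      exact ⟨hy1, e.right_inv hy2⟩
    refine ⟨hev.mono fun y hy => ⟨_, hy.1, hy.2⟩, hsymm.congr_of_eventuallyEq ?_⟩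
    filter_upwards [hev] with y hy
    have hy' : y ∈ G '' S := ⟨_, hy.1, hy.2⟩
    exact hinj (Function.invFunOn_mem hy') hy.1 ((Function.invFunOn_eq hy').trans hy.2.symm)
  constructor
  · rw [isOpen_iff_mem_nhds]
    rintro _ ⟨x, hx, rfl⟩
    exact (key x hx).1
  · rintro _ ⟨x, hx, rfl⟩
    exact (key x hx).2.contDiffWithinAt

end Antiderivative

/-! ### Cylindrical coordinates and rotations. -/

section Cylindrical

@[simp] theorem cyl_apply_zero (r θ z : ℝ) : cyl r θ z 0 = r * Real.cos θ := rfl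
@[simp] theorem cyl_apply_one (r θ z : ℝ) : cyl r θ z 1 = r * Real.sin θ := rfl
@[simp] theorem cyl_apply_two (r θ z : ℝ) : cyl r θ z 2 = z := rfl

theorem rotZ_cyl (τ r θ z : ℝ) : rotZ τ (cyl r θ z) = cyl r (τ + θ) z := by
  ext i
  fin_cases i <;> simp [rotZ, cyl, Real.cos_add, Real.sin_add] <;> ring

theorem norm_sq_eq_three (x : EuclideanSpace ℝ (Fin 3)) :
    ‖x‖ ^ 2 = x 0 ^ 2 + x 1 ^ 2 + x 2 ^ 2 := by
  rw [EuclideanSpace.real_norm_sq_eq, Fin.sum_univ_three]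

theorem inner_eq_three (x y : EuclideanSpace ℝ (Fin 3)) :
    inner ℝ x y = x 0 * y 0 + x 1 * y 1 + x 2 * y 2 := by
  rw [PiLp.inner_apply, Fin.sum_univ_three]
  simp only [RCLike.inner_apply, conj_trivial]
  ring

theorem norm_sq_rotZ (τ : ℝ) (x : EuclideanSpace ℝ (Fin 3)) : ‖rotZ τ x‖ ^ 2 = ‖x‖ ^ 2 := by
  simp only [norm_sq_eq_three, rotZ]
  simp
  linear_combination (x 0 ^ 2 + x 1 ^ 2) * Real.sin_sq_add_cos_sq τ

theorem rotZ_smul (τ a : ℝ) (x : EuclideanSpace ℝ (Fin 3)) : rotZ τ (a • x) = a • rotZ τ x := by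
  ext i
  fin_cases i <;> simp [rotZ] <;> ring

/-- Multiplying the velocity by a function of the pressure and relabelling the pressure preserve
the axial symmetry. -/
theorem IsAxisymmetric.smul_comp {V : Set (EuclideanSpace ℝ (Fin 3))}
    {u : EuclideanSpace ℝ (Fin 3) → EuclideanSpace ℝ (Fin 3)}
    {p : EuclideanSpace ℝ (Fin 3) → ℝ} (h : IsAxisymmetric V u p) (φ G : ℝ → ℝ) :
    IsAxisymmetric V (fun x => φ (p x) • u x) (fun x => G (p x)) := by
  intro τ x hx
  obtain ⟨h1, h2⟩ := h τ x hx
  simp only [h1, h2, rotZ_smul, and_self]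

theorem cyl_mem_revolve {U : Set (ℝ × ℝ)} {r z : ℝ} (hr : 0 ≤ r) (θ : ℝ) :
    cyl r θ z ∈ revolve U ↔ (r, z) ∈ U := by
  have : Real.sqrt ((r * Real.cos θ) ^ 2 + (r * Real.sin θ) ^ 2) = r := by
    rw [show (r * Real.cos θ) ^ 2 + (r * Real.sin θ) ^ 2 = r ^ 2 by
      linear_combination r ^ 2 * Real.sin_sq_add_cos_sq θ, Real.sqrt_sq hr]
  simp [revolve, this]

theorem isOpen_revolve {U : Set (ℝ × ℝ)} (hU : IsOpen U) : IsOpen (revolve U) :=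
  hU.preimage (f := fun x : EuclideanSpace ℝ (Fin 3) => (Real.sqrt (x 0 ^ 2 + x 1 ^ 2), x 2))
    (by fun_prop)

theorem exists_eq_cyl (x : EuclideanSpace ℝ (Fin 3)) :
    ∃ θ, x = cyl (Real.sqrt (x 0 ^ 2 + x 1 ^ 2)) θ (x 2) := by
  refine ⟨Complex.arg ⟨x 0, x 1⟩, ?_⟩
  have hn : ‖(⟨x 0, x 1⟩ : ℂ)‖ = Real.sqrt (x 0 ^ 2 + x 1 ^ 2) := by
    rw [Complex.norm_def, Complex.normSq_mk]; ring_nf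
  ext i
  fin_cases i
  · have := Complex.norm_mul_cos_arg ⟨x 0, x 1⟩
    rw [hn] at this
    simpa using this.symm
  · have := Complex.norm_mul_sin_arg ⟨x 0, x 1⟩
    rw [hn] at this
    simpa using this.symm
  · rfl

theorem hasDerivAt_cyl {f g h : ℝ → ℝ} {f' g' h' s : ℝ} (hf : HasDerivAt f f' s)
    (hg : HasDerivAt g g' s) (hh : HasDerivAt h h' s) :
    HasDerivAt (fun s => cyl (f s) (g s) (h s))
      !₂[f' * Real.cos (g s) - f s * Real.sin (g s) * g',
        f' * Real.sin (g s) + f s * Real.cos (g s) * g', h'] s := by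
  rw [hasDerivAt_iff_hasFDerivAt, ← hasFDerivWithinAt_univ, hasFDerivWithinAt_euclidean]
  intro i
  rw [hasFDerivWithinAt_univ]
  fin_cases i
  · have := (hf.mul hg.cos).hasFDerivAt
    convert! this using 1
    ext; simp; ring
  · have := (hf.mul hg.sin).hasFDerivAt
    convert! this using 1
    ext; simp; ring
  · have := hh.hasFDerivAt
    convert! this using 1

theorem hasDerivAt_euclidean_apply {n : ℕ} {f : ℝ → EuclideanSpace ℝ (Fin n)}
    {f' : EuclideanSpace ℝ (Fin n)} {s : ℝ} (hf : HasDerivAt f f' s) (i : Fin n) :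
    HasDerivAt (fun s => f s i) (f' i) s := by
  have := (EuclideanSpace.proj (𝕜 := ℝ) i).hasFDerivAt.comp_hasDerivAt s hf
  exact this

/-- Reduces directional derivatives of `u` to the nine partial derivatives, so that the flow
equations become linear relations between scalars. -/
theorem map_eq_three {E : Type*} [AddCommGroup E] [Module ℝ E]
    [TopologicalSpace E] (L : EuclideanSpace ℝ (Fin 3) →L[ℝ] E) (x : EuclideanSpace ℝ (Fin 3)) :
    L x = x 0 • L (EuclideanSpace.single 0 1) + x 1 • L (EuclideanSpace.single 1 1) +
      x 2 • L (EuclideanSpace.single 2 1) := by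
  conv_lhs => rw [show x = x 0 • EuclideanSpace.single 0 (1 : ℝ) +
    x 1 • EuclideanSpace.single 1 (1 : ℝ) + x 2 • EuclideanSpace.single 2 (1 : ℝ) by
      ext i; fin_cases i <;> simp]
  simp only [map_add, map_smul]

end Cylindrical

/-! ### Equivalent flows. -/

section Reparametrization

variable {n : ℕ} {V : Set (EuclideanSpace ℝ (Fin n))}
  {u : EuclideanSpace ℝ (Fin n) → EuclideanSpace ℝ (Fin n)} {p : EuclideanSpace ℝ (Fin n) → ℝ}

theorem hasGradientAt_comp {G : ℝ → ℝ} {g : ℝ} {x : EuclideanSpace ℝ (Fin n)}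
    (hG : HasDerivAt G g (p x)) (hp : DifferentiableAt ℝ p x) :
    HasGradientAt (fun y => G (p y)) (g • gradient p x) x := by
  have h := hG.comp_hasFDerivAt x hp.hasFDerivAt
  rw [hasGradientAt_iff_hasFDerivAt]
  convert! h using 1
  rw [map_smul, toDual_gradient]

/-- A flow equivalent to a Gavrilov flow through `φ` and an antiderivative of `φ²` is again a
Gavrilov flow. -/
theorem IsGavrilovFlow.smul_comp (h : IsGavrilovFlow V u p) (hV : IsOpen V)
    (hS : IsOpen (p '' V)) {φ G : ℝ → ℝ} (hφ : ContDiffOn ℝ ∞ φ (p '' V))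
    (hGs : ContDiffOn ℝ ∞ G (p '' V)) (hG : ∀ c ∈ p '' V, HasDerivAt G (φ c ^ 2) c) :
    IsGavrilovFlow V (fun x => φ (p x) • u x) (fun x => G (p x)) := by
  have hp : ∀ x ∈ V, DifferentiableAt ℝ p x := fun x hx =>
    (h.smooth_pressure.contDiffAt (hV.mem_nhds hx)).differentiableAt (by simp)
  have hu : ∀ x ∈ V, DifferentiableAt ℝ u x := fun x hx =>
    (h.smooth_velocity.contDiffAt (hV.mem_nhds hx)).differentiableAt (by simp)
  have hφd : ∀ x ∈ V, DifferentiableAt ℝ φ (p x) := fun x hx =>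
    (hφ.contDiffAt (hS.mem_nhds (mem_image_of_mem p hx))).differentiableAt (by simp)
  have hgrad : ∀ x ∈ V, gradient (fun x => G (p x)) x = φ (p x) ^ 2 • gradient p x :=
    fun x hx => (hasGradientAt_comp (hG _ (mem_image_of_mem p hx)) (hp x hx)).gradient
  have hpu : ∀ x ∈ V, fderiv ℝ p x (u x) = 0 := fun x hx => by
    rw [← inner_gradient_left, real_inner_comm]; exact h.orthogonal x hx
  have hfd : ∀ x ∈ V, ∀ w, fderiv ℝ (fun x => φ (p x) • u x) x w =
      φ (p x) • fderiv ℝ u x w + (deriv φ (p x) * fderiv ℝ p x w) • u x := fun x hx w => by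
    have h1 : HasFDerivAt (fun x => φ (p x)) (deriv φ (p x) • fderiv ℝ p x) x :=
      (hφd x hx).hasDerivAt.comp_hasFDerivAt x (hp x hx).hasFDerivAt
    rw [(h1.fun_smul (hu x hx).hasFDerivAt).fderiv]
    simp
  refine ⟨?_, ?_, fun x hx => ?_, fun x hx => ?_, fun x hx => ?_⟩
  · exact (hφ.comp h.smooth_pressure (mapsTo_image p V)).smul h.smooth_velocity
  · exact hGs.comp h.smooth_pressure (mapsTo_image p V)
  · rw [hfd x hx, hgrad x hx, map_smul, map_smul, hpu x hx, smul_zero, mul_zero, zero_smul,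
      add_zero, smul_smul, ← sq, ← smul_add, h.euler x hx, smul_zero]
  · simp only [hfd x hx, PiLp.add_apply, PiLp.smul_apply, smul_eq_mul, Finset.sum_add_distrib,
      ← Finset.mul_sum, h.incompressible x hx, mul_zero, zero_add, mul_assoc]
    -- The extra term in the divergence is `φ'(p) u · grad p`, which vanishes by orthogonality.
    have : fderiv ℝ p x (u x) = ∑ i, fderiv ℝ p x (EuclideanSpace.single i 1) * u x i := by
      conv_lhs => rw [show u x = ∑ i, u x i • EuclideanSpace.single i (1 : ℝ) by
        ext j; simp [Pi.single_apply]]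
      simp [mul_comm]
    rw [← this, hpu x hx, mul_zero]
  · rw [hgrad x hx, inner_smul_left, inner_smul_right, h.orthogonal x hx, mul_zero, mul_zero]

end Reparametrization

/-! ### Calculus along the generatrices. -/

section Generatrix

variable {U : Set (ℝ × ℝ)} {p : EuclideanSpace ℝ (Fin 3) → ℝ} {D : Set (ℝ × ℝ)} {R Z : ℝ → ℝ → ℝ}

namespace IsArcLengthGeneratrix

theorem mem_of_mem (h : IsArcLengthGeneratrix U p D R Z) {c t : ℝ} (ht : (c, t) ∈ D) :
    (R c t, Z c t) ∈ U ∧ p (cyl (R c t) 0 (Z c t)) = c := by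
  have : (R c t, Z c t) ∈ {q : ℝ × ℝ | q ∈ U ∧ p (cyl q.1 0 q.2) = c} := by
    rw [← h.image_eq c]; exact ⟨t, ht, rfl⟩
  exact this

theorem hasDerivAt_R (h : IsArcLengthGeneratrix U p D R Z) {c t : ℝ} (ht : (c, t) ∈ D) :
    HasDerivAt (R c) (deriv (R c) t) t :=
  hasDerivAt_snd h.isOpen_domain h.smooth_R ht

theorem hasDerivAt_Z (h : IsArcLengthGeneratrix U p D R Z) {c t : ℝ} (ht : (c, t) ∈ D) :
    HasDerivAt (Z c) (deriv (Z c) t) t :=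
  hasDerivAt_snd h.isOpen_domain h.smooth_Z ht

theorem hasDerivAt_deriv_R (h : IsArcLengthGeneratrix U p D R Z) {c t : ℝ} (ht : (c, t) ∈ D) :
    HasDerivAt (deriv (R c)) (deriv (deriv (R c)) t) t :=
  hasDerivAt_snd (F := fun c => deriv (R c)) h.isOpen_domain
    (contDiffOn_deriv_snd h.isOpen_domain h.smooth_R) ht

theorem hasDerivAt_deriv_Z (h : IsArcLengthGeneratrix U p D R Z) {c t : ℝ} (ht : (c, t) ∈ D) :
    HasDerivAt (deriv (Z c)) (deriv (deriv (Z c)) t) t :=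
  hasDerivAt_snd (F := fun c => deriv (Z c)) h.isOpen_domain
    (contDiffOn_deriv_snd h.isOpen_domain h.smooth_Z) ht

theorem coordT_eq (h : IsArcLengthGeneratrix U p D R Z) {c t : ℝ} (ht : (c, t) ∈ D) (θ : ℝ) :
    coordT R Z c t θ =
      !₂[deriv (R c) t * Real.cos θ, deriv (R c) t * Real.sin θ, deriv (Z c) t] := by
  have := (hasDerivAt_cyl (h.hasDerivAt_R ht) (hasDerivAt_const t θ) (h.hasDerivAt_Z ht)).deriv
  rw [coordT, this]
  simp

theorem unit_speed_deriv (h : IsArcLengthGeneratrix U p D R Z) {c t : ℝ} (ht : (c, t) ∈ D) :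
    deriv (R c) t * deriv (deriv (R c)) t + deriv (Z c) t * deriv (deriv (Z c)) t = 0 := by
  have h1 := ((h.hasDerivAt_deriv_R ht).fun_pow 2).fun_add ((h.hasDerivAt_deriv_Z ht).fun_pow 2)
  have h2 : (fun s => deriv (R c) s ^ 2 + deriv (Z c) s ^ 2) =ᶠ[nhds t] fun _ => (1 : ℝ) :=
    (eventually_mem_snd h.isOpen_domain ht).mono fun s hs => h.unit_speed c s hs
  have h3 := h1.unique ((hasDerivAt_const t (1 : ℝ)).congr_of_eventuallyEq h2)
  simp at h3
  linarith

theorem contDiffOn_cyl (h : IsArcLengthGeneratrix U p D R Z) :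
    ContDiffOn ℝ ∞ (fun q : ℝ × ℝ => cyl (R q.1 q.2) 0 (Z q.1 q.2)) D := by
  rw [contDiffOn_euclidean]
  intro i
  fin_cases i
  · simpa using h.smooth_R
  · simpa using contDiffOn_const
  · simpa using h.smooth_Z

theorem hasDerivAt_cyl_snd (h : IsArcLengthGeneratrix U p D R Z) {c t : ℝ} (ht : (c, t) ∈ D) :
    HasDerivAt (fun s => cyl (R c s) 0 (Z c s)) !₂[deriv (R c) t, 0, deriv (Z c) t] t := by
  simpa using hasDerivAt_cyl (h.hasDerivAt_R ht) (hasDerivAt_const t 0) (h.hasDerivAt_Z ht)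

theorem hasDerivAt_cyl_fst (h : IsArcLengthGeneratrix U p D R Z) {c t : ℝ} (ht : (c, t) ∈ D) :
    HasDerivAt (fun q => cyl (R q t) 0 (Z q t))
      !₂[deriv (fun q => R q t) c, 0, deriv (fun q => Z q t) c] c := by
  simpa using hasDerivAt_cyl (hasDerivAt_fst h.isOpen_domain h.smooth_R ht)
    (hasDerivAt_const c 0) (hasDerivAt_fst h.isOpen_domain h.smooth_Z ht)

theorem contDiffOn_jacobianRZ (h : IsArcLengthGeneratrix U p D R Z) :
    ContDiffOn ℝ ∞ (fun q : ℝ × ℝ => jacobianRZ R Z q.1 q.2) D :=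
  ((contDiffOn_deriv_fst h.isOpen_domain h.smooth_R).mul
    (contDiffOn_deriv_snd h.isOpen_domain h.smooth_Z)).sub
  ((contDiffOn_deriv_snd h.isOpen_domain h.smooth_R).mul
    (contDiffOn_deriv_fst h.isOpen_domain h.smooth_Z))

theorem hasDerivAt_jacobianRZ (h : IsArcLengthGeneratrix U p D R Z) {c t : ℝ}
    (ht : (c, t) ∈ D) :
    HasDerivAt (jacobianRZ R Z c)
      (deriv (fun q => deriv (R q) t) c * deriv (Z c) t +
        deriv (fun q => R q t) c * deriv (deriv (Z c)) t -
        (deriv (deriv (R c)) t * deriv (fun q => Z q t) c +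
          deriv (R c) t * deriv (fun q => deriv (Z q) t) c)) t := by
  have hR := hasDerivAt_snd (F := fun c s => deriv (fun q => R q s) c) h.isOpen_domain
    (contDiffOn_deriv_fst h.isOpen_domain h.smooth_R) ht
  have hZ := hasDerivAt_snd (F := fun c s => deriv (fun q => Z q s) c) h.isOpen_domain
    (contDiffOn_deriv_fst h.isOpen_domain h.smooth_Z) ht
  rw [deriv_fst_deriv_snd_comm h.isOpen_domain h.smooth_R ht] at hR
  rw [deriv_fst_deriv_snd_comm h.isOpen_domain h.smooth_Z ht] at hZ
  exact (hR.mul (h.hasDerivAt_deriv_Z ht)).sub ((h.hasDerivAt_deriv_R ht).mul hZ)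

end IsArcLengthGeneratrix

theorem coordTheta_eq (R Z : ℝ → ℝ → ℝ) (c t θ : ℝ) :
    coordTheta R Z c t θ = !₂[-(R c t * Real.sin θ), R c t * Real.cos θ, 0] := by
  have := (hasDerivAt_cyl (hasDerivAt_const θ (R c t)) (hasDerivAt_id θ)
    (hasDerivAt_const θ (Z c t))).deriv
  simp only [id] at this
  rw [coordTheta, this]
  simp

end Generatrix

/-! ### The flow equations in the frame of the generatrices. -/

namespace RegularAxisymmetricFlow

variable {U : Set (ℝ × ℝ)} {u : EuclideanSpace ℝ (Fin 3) → EuclideanSpace ℝ (Fin 3)}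
  {p : EuclideanSpace ℝ (Fin 3) → ℝ} {D : Set (ℝ × ℝ)} {R Z : ℝ → ℝ → ℝ} {c t : ℝ}

theorem cyl_mem (h : RegularAxisymmetricFlow U u p D R Z) (hr : ∀ q ∈ U, 0 < q.1)
    (ht : (c, t) ∈ D) (θ : ℝ) : cyl (R c t) θ (Z c t) ∈ revolve U :=
  (cyl_mem_revolve (hr _ (h.generatrix.mem_of_mem ht).1).le θ).2 (h.generatrix.mem_of_mem ht).1

theorem exists_eq_cyl (h : RegularAxisymmetricFlow U u p D R Z)
    {x : EuclideanSpace ℝ (Fin 3)} (hx : x ∈ revolve U) :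
    ∃ θ t, (p x, t) ∈ D ∧ x = cyl (R (p x) t) θ (Z (p x) t) := by
  obtain ⟨θ, hθ⟩ := _root_.exists_eq_cyl x
  set r := Real.sqrt (x 0 ^ 2 + x 1 ^ 2) with hr
  have hU : (r, x 2) ∈ U := hx
  have hmem : cyl r 0 (x 2) ∈ revolve U := (cyl_mem_revolve (Real.sqrt_nonneg _) 0).2 hU
  have hp : p (cyl r 0 (x 2)) = p x := by
    have := (h.axisymmetric θ _ hmem).2
    rw [rotZ_cyl, add_zero, ← hθ] at this
    exact this.symm
  have : (r, x 2) ∈ (fun t => (R (p x) t, Z (p x) t)) '' {t | (p x, t) ∈ D} := by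
    rw [h.generatrix.image_eq]; exact ⟨hU, hp⟩
  obtain ⟨t, ht, he⟩ := this
  refine ⟨θ, t, ht, ?_⟩
  simp only [Prod.mk.injEq] at he
  rw [he.1, he.2]
  exact hθ

theorem image_fst (h : RegularAxisymmetricFlow U u p D R Z) (hr : ∀ q ∈ U, 0 < q.1) :
    Prod.fst '' D = p '' revolve U := by
  ext c
  constructor
  · rintro ⟨⟨c, t⟩, ht, rfl⟩
    exact ⟨_, h.cyl_mem hr ht 0, (h.generatrix.mem_of_mem ht).2⟩
  · rintro ⟨x, hx, rfl⟩
    obtain ⟨θ, t, ht, -⟩ := h.exists_eq_cyl hx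
    exact ⟨_, ht, rfl⟩

theorem isOpen_image (h : RegularAxisymmetricFlow U u p D R Z) (hr : ∀ q ∈ U, 0 < q.1) :
    IsOpen (p '' revolve U) := by
  rw [← h.image_fst hr]
  exact isOpenMap_fst _ h.generatrix.isOpen_domain

theorem velocity_cyl (h : RegularAxisymmetricFlow U u p D R Z) (hr : ∀ q ∈ U, 0 < q.1)
    (ht : (c, t) ∈ D) (θ : ℝ) :
    u (cyl (R c t) θ (Z c t)) = rotZ θ (u (cyl (R c t) 0 (Z c t))) := by
  rw [← (h.axisymmetric θ _ (h.cyl_mem hr ht 0)).1, rotZ_cyl, add_zero]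

theorem hasFDerivAt_velocity (h : RegularAxisymmetricFlow U u p D R Z) (hU : IsOpen U)
    {x : EuclideanSpace ℝ (Fin 3)} (hx : x ∈ revolve U) : HasFDerivAt u (fderiv ℝ u x) x :=
  ((h.flow.smooth_velocity.contDiffAt ((isOpen_revolve hU).mem_nhds hx)).differentiableAt
    (by simp)).hasFDerivAt

theorem hasFDerivAt_pressure (h : RegularAxisymmetricFlow U u p D R Z) (hU : IsOpen U)
    {x : EuclideanSpace ℝ (Fin 3)} (hx : x ∈ revolve U) : HasFDerivAt p (fderiv ℝ p x) x :=
  ((h.flow.smooth_pressure.contDiffAt ((isOpen_revolve hU).mem_nhds hx)).differentiableAt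
    (by simp)).hasFDerivAt

/-- The chain rule for `p` along the three coordinate curves: `p` is constant in `θ` and in `t`, and
equals the label `c` itself along the third. -/
theorem gradient_relations (h : RegularAxisymmetricFlow U u p D R Z) (hU : IsOpen U)
    (hr : ∀ q ∈ U, 0 < q.1) (ht : (c, t) ∈ D) :
    gradient p (cyl (R c t) 0 (Z c t)) 1 = 0 ∧
    gradient p (cyl (R c t) 0 (Z c t)) 0 * deriv (R c) t +
      gradient p (cyl (R c t) 0 (Z c t)) 2 * deriv (Z c) t = 0 ∧
    gradient p (cyl (R c t) 0 (Z c t)) 0 * deriv (fun q => R q t) c +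
      gradient p (cyl (R c t) 0 (Z c t)) 2 * deriv (fun q => Z q t) c = 1 := by
  have hx := h.cyl_mem hr ht 0
  have hp := h.hasFDerivAt_pressure hU hx
  have hR := hr _ (h.generatrix.mem_of_mem ht).1
  refine ⟨?_, ?_, ?_⟩
  · have h1 := hp.comp_hasDerivAt (f := fun s => cyl (R c t) s (Z c t)) 0
      (hasDerivAt_cyl (hasDerivAt_const 0 (R c t)) (hasDerivAt_id 0) (hasDerivAt_const 0 (Z c t)))
    have h2 : p ∘ (fun s => cyl (R c t) s (Z c t)) = fun _ => p (cyl (R c t) 0 (Z c t)) := by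
      funext s
      rw [← (h.axisymmetric s _ hx).2, rotZ_cyl, add_zero]; rfl
    rw [h2] at h1
    have h3 := h1.unique (hasDerivAt_const 0 _)
    rw [← inner_gradient_left, inner_eq_three] at h3
    simpa [hR.ne'] using h3
  · have h1 := hp.comp_hasDerivAt (f := fun s => cyl (R c s) 0 (Z c s)) t
      (h.generatrix.hasDerivAt_cyl_snd ht)
    have h2 : p ∘ (fun s => cyl (R c s) 0 (Z c s)) =ᶠ[nhds t] fun _ => c :=
      (eventually_mem_snd h.generatrix.isOpen_domain ht).mono fun s hs =>
        (h.generatrix.mem_of_mem hs).2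
    have h3 := h1.unique ((hasDerivAt_const t c).congr_of_eventuallyEq h2)
    rw [← inner_gradient_left, inner_eq_three] at h3
    simpa using h3
  · have h1 := hp.comp_hasDerivAt (f := fun q => cyl (R q t) 0 (Z q t)) c
      (h.generatrix.hasDerivAt_cyl_fst ht)
    have h2 : p ∘ (fun q => cyl (R q t) 0 (Z q t)) =ᶠ[nhds c] fun q => q :=
      (eventually_mem_fst h.generatrix.isOpen_domain ht).mono fun s hs =>
        (h.generatrix.mem_of_mem hs).2
    have h3 := h1.unique ((hasDerivAt_id' c).congr_of_eventuallyEq h2)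
    rw [← inner_gradient_left, inner_eq_three] at h3
    simpa using h3

theorem geomT_eq (h : RegularAxisymmetricFlow U u p D R Z) (ht : (c, t) ∈ D) :
    geomT u R Z c t = u (cyl (R c t) 0 (Z c t)) 0 * deriv (R c) t +
      u (cyl (R c t) 0 (Z c t)) 2 * deriv (Z c) t := by
  rw [geomT, norm_sq_eq_three, inner_eq_three, h.generatrix.coordT_eq ht]
  simp [h.generatrix.unit_speed c t ht]

theorem geomTheta_eq (hR : 0 < R c t) :
    geomTheta u R Z c t = u (cyl (R c t) 0 (Z c t)) 1 / R c t := by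
  rw [geomTheta, norm_sq_eq_three, inner_eq_three, coordTheta_eq]
  simp
  field_simp

theorem velocity_meridional (h : RegularAxisymmetricFlow U u p D R Z) (hU : IsOpen U)
    (hr : ∀ q ∈ U, 0 < q.1) (ht : (c, t) ∈ D) :
    u (cyl (R c t) 0 (Z c t)) 0 = geomT u R Z c t * deriv (R c) t ∧
    u (cyl (R c t) 0 (Z c t)) 2 = geomT u R Z c t * deriv (Z c) t := by
  obtain ⟨h1, h2, h3⟩ := h.gradient_relations hU hr ht
  have h4 := h.flow.orthogonal _ (h.cyl_mem hr ht 0)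
  have h5 := h.generatrix.unit_speed c t ht
  rw [inner_eq_three, h1, mul_zero, add_zero] at h4
  rw [h.geomT_eq ht]
  generalize gradient p (cyl (R c t) 0 (Z c t)) 0 = g0 at *
  generalize gradient p (cyl (R c t) 0 (Z c t)) 2 = g2 at *
  generalize u (cyl (R c t) 0 (Z c t)) 0 = u0 at *
  generalize u (cyl (R c t) 0 (Z c t)) 2 = u2 at *
  generalize deriv (fun q => R q t) c = Rc at *
  generalize deriv (fun q => Z q t) c = Zc at *
  generalize deriv (R c) t = Rt at *
  generalize deriv (Z c) t = Zt at *
  -- The meridional part of `u` and the tangent are both orthogonal to the plane vector `(g0, g2)`,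
  -- which `h3` shows to be nonzero; hence they are parallel.
  have h6 : u0 * Zt - u2 * Rt = 0 := by
    linear_combination (Rc * Zt - Rt * Zc) * h4 + (u0 * Zc - u2 * Rc) * h2 -
      (u0 * Zt - u2 * Rt) * h3
  constructor
  · linear_combination -u0 * h5 + Zt * h6
  · linear_combination -u2 * h5 - Rt * h6

theorem velocity_eq (h : RegularAxisymmetricFlow U u p D R Z) (hU : IsOpen U)
    (hr : ∀ q ∈ U, 0 < q.1) (ht : (c, t) ∈ D) (θ : ℝ) :
    u (cyl (R c t) θ (Z c t)) =
      geomT u R Z c t • coordT R Z c t θ + geomTheta u R Z c t • coordTheta R Z c t θ := by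
  have hR := hr _ (h.generatrix.mem_of_mem ht).1
  obtain ⟨h0, h2⟩ := h.velocity_meridional hU hr ht
  rw [h.velocity_cyl hr ht, h.generatrix.coordT_eq ht, coordTheta_eq, geomTheta_eq hR, rotZ,
    h0, h2]
  have hR' : R c t ≠ 0 := hR.ne'
  ext i
  fin_cases i
  · simp
    field_simp
    ring
  · simp
    field_simp
  · simp

theorem norm_sq_velocity (h : RegularAxisymmetricFlow U u p D R Z) (hU : IsOpen U)
    (hr : ∀ q ∈ U, 0 < q.1) (ht : (c, t) ∈ D) (θ : ℝ) :
    ‖u (cyl (R c t) θ (Z c t))‖ ^ 2 =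
      geomT u R Z c t ^ 2 + u (cyl (R c t) 0 (Z c t)) 1 ^ 2 := by
  obtain ⟨h0, h2⟩ := h.velocity_meridional hU hr ht
  rw [h.velocity_cyl hr ht, norm_sq_rotZ, norm_sq_eq_three, h0, h2]
  linear_combination geomT u R Z c t ^ 2 * h.generatrix.unit_speed c t ht

theorem contDiffOn_velocity_cyl (h : RegularAxisymmetricFlow U u p D R Z)
    (hr : ∀ q ∈ U, 0 < q.1) (i : Fin 3) :
    ContDiffOn ℝ ∞ (fun q : ℝ × ℝ => u (cyl (R q.1 q.2) 0 (Z q.1 q.2)) i) D :=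
  contDiffOn_euclidean.1 (h.flow.smooth_velocity.comp h.generatrix.contDiffOn_cyl
    fun _ hq => h.cyl_mem hr hq 0) i

theorem contDiffOn_geomT (h : RegularAxisymmetricFlow U u p D R Z)
    (hr : ∀ q ∈ U, 0 < q.1) :
    ContDiffOn ℝ ∞ (fun q : ℝ × ℝ => geomT u R Z q.1 q.2) D := by
  have hD := h.generatrix.isOpen_domain
  refine ContDiffOn.congr (((h.contDiffOn_velocity_cyl hr 0).mul
    (contDiffOn_deriv_snd hD h.generatrix.smooth_R)).add
    ((h.contDiffOn_velocity_cyl hr 2).mul (contDiffOn_deriv_snd hD h.generatrix.smooth_Z)))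
    fun q hq => h.geomT_eq hq

/-- The Euler equations and the incompressibility along the generatrices. -/
theorem euler_along_generatrix (h : RegularAxisymmetricFlow U u p D R Z) (hU : IsOpen U)
    (hr : ∀ q ∈ U, 0 < q.1) (ht : (c, t) ∈ D) {v' y' : ℝ}
    (hv : HasDerivAt (geomT u R Z c) v' t)
    (hy : HasDerivAt (fun s => u (cyl (R c s) 0 (Z c s)) 1) y' t) :
    geomT u R Z c t * (v' * deriv (R c) t + geomT u R Z c t * deriv (deriv (R c)) t) -
      u (cyl (R c t) 0 (Z c t)) 1 ^ 2 / R c t = -gradient p (cyl (R c t) 0 (Z c t)) 0 ∧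
    geomT u R Z c t * (y' * R c t + u (cyl (R c t) 0 (Z c t)) 1 * deriv (R c) t) = 0 ∧
    geomT u R Z c t * (v' * deriv (Z c) t + geomT u R Z c t * deriv (deriv (Z c)) t) =
      -gradient p (cyl (R c t) 0 (Z c t)) 2 ∧
    deriv (fun s => geomT u R Z c s * R c s * jacobianRZ R Z c s) t = 0 := by
  have hD := h.generatrix.isOpen_domain
  have hx := h.cyl_mem hr ht 0
  have hRpos := hr _ (h.generatrix.mem_of_mem ht).1
  have hLu := h.hasFDerivAt_velocity hU hx
  obtain ⟨hg1, -, -⟩ := h.gradient_relations hU hr ht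
  obtain ⟨hu0, hu2⟩ := h.velocity_meridional hU hr ht
  have heul := h.flow.euler _ hx
  have hdiv := h.flow.incompressible _ hx
  rw [Fin.sum_univ_three] at hdiv
  have hvc := hasDerivAt_fst hD (h.contDiffOn_geomT hr) ht
  have hRc := hasDerivAt_fst (F := fun c => deriv (R c)) hD
    (contDiffOn_deriv_snd hD h.generatrix.smooth_R) ht
  have hZc := hasDerivAt_fst (F := fun c => deriv (Z c)) hD
    (contDiffOn_deriv_snd hD h.generatrix.smooth_Z) ht
  -- derivative of the velocity along the generatrix
  have ct := hLu.comp_hasDerivAt t (h.generatrix.hasDerivAt_cyl_snd ht)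
  have evt := eventually_mem_snd hD ht
  have t0 := (hasDerivAt_euclidean_apply ct 0).unique
    ((hv.mul (h.generatrix.hasDerivAt_deriv_R ht)).congr_of_eventuallyEq
      (evt.mono fun s hs => (h.velocity_meridional hU hr hs).1))
  have t1 := (hasDerivAt_euclidean_apply ct 1).unique hy
  have t2 := (hasDerivAt_euclidean_apply ct 2).unique
    ((hv.mul (h.generatrix.hasDerivAt_deriv_Z ht)).congr_of_eventuallyEq
      (evt.mono fun s hs => (h.velocity_meridional hU hr hs).2))
  -- derivative of the velocity across the isobaric surfaces
  have cc := hLu.comp_hasDerivAt c (h.generatrix.hasDerivAt_cyl_fst ht)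
  have evc := eventually_mem_fst hD ht
  have c0 := (hasDerivAt_euclidean_apply cc 0).unique
    ((hvc.mul hRc).congr_of_eventuallyEq
      (evc.mono fun s hs => (h.velocity_meridional hU hr hs).1))
  have c2 := (hasDerivAt_euclidean_apply cc 2).unique
    ((hvc.mul hZc).congr_of_eventuallyEq
      (evc.mono fun s hs => (h.velocity_meridional hU hr hs).2))
  -- derivative of the velocity along the parallels
  have cθ := hLu.comp_hasDerivAt (f := fun s => cyl (R c t) s (Z c t)) 0
    (hasDerivAt_cyl (hasDerivAt_const 0 (R c t)) (hasDerivAt_id 0) (hasDerivAt_const 0 (Z c t)))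
  have eθ : u ∘ (fun s => cyl (R c t) s (Z c t)) = fun s => rotZ s (u (cyl (R c t) 0 (Z c t))) :=
    funext fun s => h.velocity_cyl hr ht s
  rw [eθ] at cθ
  have r0 := (hasDerivAt_euclidean_apply cθ 0).unique
    (((Real.hasDerivAt_cos 0).mul_const (u (cyl (R c t) 0 (Z c t)) 0)).fun_sub
      ((Real.hasDerivAt_sin 0).mul_const (u (cyl (R c t) 0 (Z c t)) 1)))
  have r1 := (hasDerivAt_euclidean_apply cθ 1).unique
    (((Real.hasDerivAt_sin 0).mul_const (u (cyl (R c t) 0 (Z c t)) 0)).fun_add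
      ((Real.hasDerivAt_cos 0).mul_const (u (cyl (R c t) 0 (Z c t)) 1)))
  have r2 := (hasDerivAt_euclidean_apply cθ 2).unique
    (hasDerivAt_const 0 (u (cyl (R c t) 0 (Z c t)) 2))
  have hlam := (hv.fun_mul (h.generatrix.hasDerivAt_R ht)).fun_mul
    (h.generatrix.hasDerivAt_jacobianRZ ht)
  rw [hlam.deriv, jacobianRZ]
  rw [map_eq_three] at t0 t1 t2 c0 c2 r0 r1 r2 heul
  have e0 := congrArg (fun w : EuclideanSpace ℝ (Fin 3) => w 0) heul
  have e1 := congrArg (fun w : EuclideanSpace ℝ (Fin 3) => w 1) heul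
  have e2 := congrArg (fun w : EuclideanSpace ℝ (Fin 3) => w 2) heul
  simp [hg1, hRpos.ne'] at t0 t1 t2 c0 c2 r0 r1 r2 e0 e1 e2
  rw [hu0] at e0 e1 e2 r1
  rw [hu2] at e0 e1 e2
  -- The centripetal term: rotating `u` along a parallel gives `R ∂_y u_x = -y` at `θ = 0`.
  have hyR : u (cyl (R c t) 0 (Z c t)) 1 ^ 2 / R c t = -(u (cyl (R c t) 0 (Z c t)) 1 *
      fderiv ℝ u (cyl (R c t) 0 (Z c t)) (EuclideanSpace.single 1 1) 0) := by
    rw [div_eq_iff hRpos.ne']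
    linear_combination u (cyl (R c t) 0 (Z c t)) 1 * r0
  refine ⟨?_, ?_, ?_, ?_⟩
  · linear_combination e0 - geomT u R Z c t * t0 - hyR
  · linear_combination R c t * e1 - R c t * geomT u R Z c t * t1 -
      u (cyl (R c t) 0 (Z c t)) 1 * r1
  · linear_combination e2 - geomT u R Z c t * t2 - u (cyl (R c t) 0 (Z c t)) 1 * r2
  -- For a plane linear map `A`, `det(a, b) tr A = det(A a, b) + det(a, A b)`. With `a = ∂_p`, `b =
  -- ∂_t` and the angular contribution `v R_t / R`, this yields `(v R J)_t = R J div u`; no division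
  -- by `J` is needed.
  · linear_combination R c t * (deriv (fun q => R q t) c * deriv (Z c) t -
        deriv (R c) t * deriv (fun q => Z q t) c) * hdiv -
      R c t * (deriv (Z c) t * c0 - deriv (fun q => Z q t) c * t0 +
        deriv (fun q => R q t) c * t2 - deriv (R c) t * c2) -
      (deriv (fun q => R q t) c * deriv (Z c) t -
        deriv (R c) t * deriv (fun q => Z q t) c) * r1

end RegularAxisymmetricFlow

/-! ### Functions of the pressure and the normalized equations. -/

namespace RegularAxisymmetricFlow

variable {U : Set (ℝ × ℝ)} {u : EuclideanSpace ℝ (Fin 3) → EuclideanSpace ℝ (Fin 3)}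
  {p : EuclideanSpace ℝ (Fin 3) → ℝ} {D : Set (ℝ × ℝ)} {R Z : ℝ → ℝ → ℝ} {c t : ℝ}

theorem hasDerivAt_geomT (h : RegularAxisymmetricFlow U u p D R Z) (hr : ∀ q ∈ U, 0 < q.1)
    (ht : (c, t) ∈ D) : HasDerivAt (geomT u R Z c) (deriv (geomT u R Z c) t) t :=
  hasDerivAt_snd h.generatrix.isOpen_domain (h.contDiffOn_geomT hr) ht

theorem hasDerivAt_velocity_one (h : RegularAxisymmetricFlow U u p D R Z)
    (hr : ∀ q ∈ U, 0 < q.1) (ht : (c, t) ∈ D) :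
    HasDerivAt (fun s => u (cyl (R c s) 0 (Z c s)) 1)
      (deriv (fun s => u (cyl (R c s) 0 (Z c s)) 1) t) t :=
  hasDerivAt_snd (F := fun c s => u (cyl (R c s) 0 (Z c s)) 1) h.generatrix.isOpen_domain
    (h.contDiffOn_velocity_cyl hr 1) ht

theorem exists_of_deriv_eq_zero (h : RegularAxisymmetricFlow U u p D R Z)
    (hr : ∀ q ∈ U, 0 < q.1) {F : ℝ → ℝ → ℝ}
    (hF : ContDiffOn ℝ ∞ (fun q : ℝ × ℝ => F q.1 q.2) D)
    (hF0 : ∀ c t, (c, t) ∈ D → deriv (F c) t = 0) :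
    ∃ g : ℝ → ℝ, ContDiffOn ℝ ∞ g (p '' revolve U) ∧ ∀ c t, (c, t) ∈ D → F c t = g c := by
  rw [← h.image_fst hr]
  exact exists_contDiffOn_of_deriv_snd_eq_zero h.generatrix.isOpen_domain h.generatrix.interval
    hF hF0

/-- The angular momentum is a function of the pressure. -/
theorem exists_angular_momentum (h : RegularAxisymmetricFlow U u p D R Z) (hU : IsOpen U)
    (hr : ∀ q ∈ U, 0 < q.1) :
    ∃ b : ℝ → ℝ, ContDiffOn ℝ ∞ b (p '' revolve U) ∧
      ∀ c t, (c, t) ∈ D → u (cyl (R c t) 0 (Z c t)) 1 * R c t = b c := by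
  refine h.exists_of_deriv_eq_zero hr (F := fun c t => u (cyl (R c t) 0 (Z c t)) 1 * R c t)
    ((h.contDiffOn_velocity_cyl hr 1).mul h.generatrix.smooth_R) fun c t ht => ?_
  have hy := h.hasDerivAt_velocity_one hr ht
  rw [(hy.fun_mul (h.generatrix.hasDerivAt_R ht)).deriv]
  obtain ⟨-, h2, -, -⟩ := h.euler_along_generatrix hU hr ht (h.hasDerivAt_geomT hr ht) hy
  exact (mul_eq_zero.1 h2).resolve_left (h.geomT_ne_zero c t ht)

/-- The mass flux is a function of the pressure. -/
theorem exists_flux (h : RegularAxisymmetricFlow U u p D R Z) (hU : IsOpen U)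
    (hr : ∀ q ∈ U, 0 < q.1) :
    ∃ l : ℝ → ℝ, ContDiffOn ℝ ∞ l (p '' revolve U) ∧
      ∀ c t, (c, t) ∈ D → geomT u R Z c t * R c t * jacobianRZ R Z c t = l c :=
  h.exists_of_deriv_eq_zero hr (F := fun c t => geomT u R Z c t * R c t * jacobianRZ R Z c t)
    (((h.contDiffOn_geomT hr).mul h.generatrix.smooth_R).mul h.generatrix.contDiffOn_jacobianRZ)
    fun _ _ ht => (h.euler_along_generatrix hU hr ht (h.hasDerivAt_geomT hr ht)
      (h.hasDerivAt_velocity_one hr ht)).2.2.2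

/-- The speed is a function of the pressure. -/
theorem exists_speed (h : RegularAxisymmetricFlow U u p D R Z) (hU : IsOpen U)
    (hr : ∀ q ∈ U, 0 < q.1) :
    ∃ d : ℝ → ℝ, ContDiffOn ℝ ∞ d (p '' revolve U) ∧ (∀ c ∈ p '' revolve U, 0 < d c) ∧
      ∀ x ∈ revolve U, ‖u x‖ ^ 2 = d (p x) := by
  obtain ⟨d, hd, hdc⟩ := h.exists_of_deriv_eq_zero hr
    (F := fun c t => geomT u R Z c t ^ 2 + u (cyl (R c t) 0 (Z c t)) 1 ^ 2)
    (((h.contDiffOn_geomT hr).pow 2).add ((h.contDiffOn_velocity_cyl hr 1).pow 2))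
    fun c t ht => by
      have hv := h.hasDerivAt_geomT hr ht
      have hy := h.hasDerivAt_velocity_one hr ht
      have hR := (hr _ (h.generatrix.mem_of_mem ht).1).ne'
      have hv0 := h.geomT_ne_zero c t ht
      obtain ⟨h1, h2, h3, -⟩ := h.euler_along_generatrix hU hr ht hv hy
      obtain ⟨-, h4, -⟩ := h.gradient_relations hU hr ht
      have h5 := h.generatrix.unit_speed c t ht
      have h6 := h.generatrix.unit_speed_deriv ht
      have h7 := (mul_eq_zero.1 h2).resolve_left hv0
      rw [((hv.fun_pow 2).fun_add (hy.fun_pow 2)).deriv]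
      dsimp only at hR
      field_simp at h1
      -- After multiplication by `R`, the centrifugal work `y² R_t` in the tangential Euler equation
      -- cancels against the conservation of angular momentum, and the tangential pressure gradient
      -- is zero.
      apply mul_left_cancel₀ hR
      simp only [Nat.cast_ofNat, Nat.add_one_sub_one, pow_one]
      linear_combination 2 * deriv (R c) t * h1 + 2 * R c t * deriv (Z c) t * h3 +
        2 * u (cyl (R c t) 0 (Z c t)) 1 * h7 - 2 * R c t * h4 -
        2 * R c t * geomT u R Z c t * deriv (geomT u R Z c) t * h5 -
        2 * R c t * geomT u R Z c t ^ 2 * h6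
  refine ⟨d, hd, ?_, ?_⟩
  · rw [← h.image_fst hr]
    rintro _ ⟨⟨c, t⟩, ht, rfl⟩
    rw [← hdc c t ht]
    have := h.geomT_ne_zero c t ht
    positivity
  · intro x hx
    obtain ⟨θ, t, ht, hxt⟩ := h.exists_eq_cyl hx
    rw [← hdc _ t ht, ← h.norm_sq_velocity hU hr ht θ, ← hxt]

/-- The second factor is the derivative of `p` along the normal `(Z_t, -R_t)`. As `grad p` is normal
to the curve, only the normal part of `(R_p, Z_p)`, which is `J`, contributes to the derivative of
`p` in its own label. Thus `J` is nonzero and has the sign of `∂p/∂n`. -/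
theorem jacobianRZ_mul_eq_one (h : RegularAxisymmetricFlow U u p D R Z) (hU : IsOpen U)
    (hr : ∀ q ∈ U, 0 < q.1) (ht : (c, t) ∈ D) :
    jacobianRZ R Z c t * (gradient p (cyl (R c t) 0 (Z c t)) 0 * deriv (Z c) t -
      gradient p (cyl (R c t) 0 (Z c t)) 2 * deriv (R c) t) = 1 := by
  obtain ⟨-, h2, h3⟩ := h.gradient_relations hU hr ht
  have h5 := h.generatrix.unit_speed c t ht
  rw [jacobianRZ]
  generalize gradient p (cyl (R c t) 0 (Z c t)) 0 = g0 at *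
  generalize gradient p (cyl (R c t) 0 (Z c t)) 2 = g2 at *
  linear_combination h3 + (g0 * deriv (fun q => R q t) c + g2 * deriv (fun q => Z q t) c) * h5 -
    (deriv (fun q => R q t) c * deriv (R c) t + deriv (fun q => Z q t) c * deriv (Z c) t) * h2

theorem jacobianRZ_ne_zero (h : RegularAxisymmetricFlow U u p D R Z) (hU : IsOpen U)
    (hr : ∀ q ∈ U, 0 < q.1) (ht : (c, t) ∈ D) : jacobianRZ R Z c t ≠ 0 :=
  left_ne_zero_of_mul_eq_one (h.jacobianRZ_mul_eq_one hU hr ht)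

/-- The normal component of the Euler equations. -/
theorem curvatureRZ_eq (h : RegularAxisymmetricFlow U u p D R Z) (hU : IsOpen U)
    (hr : ∀ q ∈ U, 0 < q.1) (ht : (c, t) ∈ D) :
    geomT u R Z c t ^ 2 * curvatureRZ R Z c t +
      u (cyl (R c t) 0 (Z c t)) 1 ^ 2 / R c t * deriv (Z c) t = (jacobianRZ R Z c t)⁻¹ := by
  obtain ⟨h1, -, h3, -⟩ := h.euler_along_generatrix hU hr ht (h.hasDerivAt_geomT hr ht)
    (h.hasDerivAt_velocity_one hr ht)
  rw [← eq_inv_of_mul_eq_one_right (h.jacobianRZ_mul_eq_one hU hr ht), curvatureRZ]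
  linear_combination deriv (R c) t * h3 - deriv (Z c) t * h1

/-- The equations satisfied by the generatrices of a flow of unit speed. -/
theorem normalized_equations (h : RegularAxisymmetricFlow U u p D R Z) (hU : IsOpen U)
    (hr : ∀ q ∈ U, 0 < q.1) (h1 : ∀ x ∈ revolve U, ‖u x‖ ^ 2 = 1)
    (hpos : ∀ c t, (c, t) ∈ D → 0 < geomT u R Z c t) :
    ∃ α b : ℝ → ℝ,
      ContDiffOn ℝ ∞ α (p '' revolve U) ∧ ContDiffOn ℝ ∞ b (p '' revolve U) ∧
      (∀ c ∈ p '' revolve U, 0 < α c) ∧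
      ∀ c t, (c, t) ∈ D →
        |b c| < R c t ∧
        deriv (R c) t ^ 2 + deriv (Z c) t ^ 2 = 1 ∧
        Real.sqrt (R c t ^ 2 - b c ^ 2) * |jacobianRZ R Z c t| = α c ^ 2 ∧
        curvatureRZ R Z c t * R c t * (R c t ^ 2 - b c ^ 2) + b c ^ 2 * deriv (Z c) t =
          Real.sign (jacobianRZ R Z c t) *
            (R c t ^ 3 * Real.sqrt (R c t ^ 2 - b c ^ 2) / α c ^ 2) ∧
        geomT u R Z c t = Real.sqrt (R c t ^ 2 - b c ^ 2) / R c t ∧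
        geomTheta u R Z c t = b c / R c t ^ 2 := by
  obtain ⟨b, hb, hbc⟩ := h.exists_angular_momentum hU hr
  obtain ⟨l, hl, hlc⟩ := h.exists_flux hU hr
  have hl0 : ∀ c ∈ p '' revolve U, l c ≠ 0 := by
    rw [← h.image_fst hr]
    rintro _ ⟨⟨c, t⟩, ht, rfl⟩
    rw [← hlc c t ht]
    exact mul_ne_zero (mul_ne_zero (hpos c t ht).ne'
      (hr _ (h.generatrix.mem_of_mem ht).1).ne') (h.jacobianRZ_ne_zero hU hr ht)
  -- `α² = |l|` is the absolute flux `v R |J|`; as `l` has no zero, both the absolute value and the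
  -- root stay smooth.
  refine ⟨fun c => Real.sqrt |l c|, b, fun c hc => ?_, hb,
    fun c hc => Real.sqrt_pos.2 (abs_pos.2 (hl0 c hc)), fun c t ht => ?_⟩
  · exact (((hl.contDiffAt ((h.isOpen_image hr).mem_nhds hc)).abs (hl0 c hc)).sqrt
      (abs_ne_zero.2 (hl0 c hc))).contDiffWithinAt
  have hR : 0 < R c t := hr _ (h.generatrix.mem_of_mem ht).1
  have hv := hpos c t ht
  have hJ := h.jacobianRZ_ne_zero hU hr ht
  have hn : geomT u R Z c t ^ 2 + u (cyl (R c t) 0 (Z c t)) 1 ^ 2 = 1 := by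
    rw [← h.norm_sq_velocity hU hr ht 0]
    exact h1 _ (h.cyl_mem hr ht 0)
  have hcurv := h.curvatureRZ_eq hU hr ht
  have hb' : b c = u (cyl (R c t) 0 (Z c t)) 1 * R c t := (hbc c t ht).symm
  have hsq : R c t ^ 2 - b c ^ 2 = (geomT u R Z c t * R c t) ^ 2 := by
    rw [hb']; linear_combination (-R c t ^ 2) * hn
  have hsqrt : Real.sqrt (R c t ^ 2 - b c ^ 2) = geomT u R Z c t * R c t := by
    rw [hsq, Real.sqrt_sq (by positivity)]
  have hα : Real.sqrt |l c| ^ 2 = geomT u R Z c t * R c t * |jacobianRZ R Z c t| := by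
    rw [Real.sq_sqrt (abs_nonneg _), ← hlc c t ht, abs_mul, abs_of_pos (mul_pos hv hR)]
  refine ⟨?_, h.generatrix.unit_speed c t ht, ?_, ?_, ?_, ?_⟩
  · apply abs_lt_of_sq_lt_sq _ hR.le
    have : 0 < (geomT u R Z c t * R c t) ^ 2 := by positivity
    linarith
  · rw [hsqrt, hα]
  · have hJs : Real.sign (jacobianRZ R Z c t) / |jacobianRZ R Z c t| =
        (jacobianRZ R Z c t)⁻¹ := by
      rcases hJ.lt_or_gt with hneg | hpos'
      · rw [Real.sign_of_neg hneg, abs_of_neg hneg, neg_div_neg_eq, one_div]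
      · rw [Real.sign_of_pos hpos', abs_of_pos hpos', one_div]
    have e : Real.sign (jacobianRZ R Z c t) * (R c t ^ 3 * (geomT u R Z c t * R c t) /
        (geomT u R Z c t * R c t * |jacobianRZ R Z c t|)) =
        R c t ^ 3 * (Real.sign (jacobianRZ R Z c t) / |jacobianRZ R Z c t|) := by
      have := abs_ne_zero.2 hJ
      field_simp
    rw [hsqrt, hα, e, hJs, ← hcurv, hsq, hb']
    field_simp
  · rw [hsqrt, mul_div_cancel_right₀ _ hR.ne']
  · rw [geomTheta_eq hR, hb']
    field_simp

end RegularAxisymmetricFlow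

/-! ### Orientation and relabelling of the generatrices. -/

namespace RegularAxisymmetricFlow

variable {U : Set (ℝ × ℝ)} {u : EuclideanSpace ℝ (Fin 3) → EuclideanSpace ℝ (Fin 3)}
  {p : EuclideanSpace ℝ (Fin 3) → ℝ} {D : Set (ℝ × ℝ)} {R Z : ℝ → ℝ → ℝ} {c t : ℝ}

/-- The sign of `u^t` is a smooth function of the pressure. -/
theorem exists_orientation (h : RegularAxisymmetricFlow U u p D R Z) (hr : ∀ q ∈ U, 0 < q.1) :
    ∃ s : ℝ → ℝ, ContDiffOn ℝ ∞ s (p '' revolve U) ∧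
      ∀ c t, (c, t) ∈ D → geomT u R Z c t / |geomT u R Z c t| = s c := by
  have hD := h.generatrix.isOpen_domain
  have hs : ContDiffOn ℝ ∞ (fun q : ℝ × ℝ => geomT u R Z q.1 q.2 / |geomT u R Z q.1 q.2|) D := by
    intro q hq
    have hv : ContDiffAt ℝ ∞ (fun q : ℝ × ℝ => geomT u R Z q.1 q.2) q :=
      (h.contDiffOn_geomT hr).contDiffAt (hD.mem_nhds hq)
    have hv0 := h.geomT_ne_zero q.1 q.2 hq
    exact (hv.fun_div (hv.abs hv0) (abs_ne_zero.2 hv0)).contDiffWithinAt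
  refine h.exists_of_deriv_eq_zero hr (F := fun c t => geomT u R Z c t / |geomT u R Z c t|) hs
    fun c t ht => ?_
  have h1 := hasDerivAt_snd (F := fun c t => geomT u R Z c t / |geomT u R Z c t|) hD hs ht
  have h2 : (fun s => (geomT u R Z c s / |geomT u R Z c s|) ^ 2) =ᶠ[nhds t] fun _ => (1 : ℝ) :=
    (eventually_mem_snd hD ht).mono fun s hs => by
      have := h.geomT_ne_zero c s hs
      simp only [div_pow, sq_abs]
      field_simp
  -- Differentiating `s² = 1` gives `2 s s' = 0` with `s ≠ 0`.
  have h3 := (h1.fun_pow 2).unique ((hasDerivAt_const t (1 : ℝ)).congr_of_eventuallyEq h2)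
  have h4 := h.geomT_ne_zero c t ht
  simpa [h4] using h3

theorem geomT_smul (φ : ℝ → ℝ) (h : RegularAxisymmetricFlow U u p D R Z) (ht : (c, t) ∈ D) :
    geomT (fun x => φ (p x) • u x) R Z c t = φ c * geomT u R Z c t := by
  simp only [geomT, (h.generatrix.mem_of_mem ht).2, real_inner_smul_left, mul_div_assoc]

/-- Passing to an equivalent flow, with the generatrices labelled by the new pressure, preserves
the standing hypotheses. -/
theorem smul_comp (h : RegularAxisymmetricFlow U u p D R Z) (hU : IsOpen U)
    (hr : ∀ q ∈ U, 0 < q.1) {φ G : ℝ → ℝ} (hφ : ContDiffOn ℝ ∞ φ (p '' revolve U))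
    (hφ0 : ∀ c ∈ p '' revolve U, φ c ≠ 0)
    (hGs : ContDiffOn ℝ ∞ G (p '' revolve U))
    (hG : ∀ c ∈ p '' revolve U, HasDerivAt G (φ c ^ 2) c)
    (hconn : IsPreconnected (p '' revolve U)) :
    ∃ (D' : Set (ℝ × ℝ)) (R' Z' : ℝ → ℝ → ℝ),
      RegularAxisymmetricFlow U (fun x => φ (p x) • u x) (fun x => G (p x)) D' R' Z' ∧
      (∀ c' t, (c', t) ∈ D' → ∃ c, (c, t) ∈ D ∧
        geomT (fun x => φ (p x) • u x) R' Z' c' t = φ c * geomT u R Z c t) ∧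
      ∀ x ∈ revolve U, ∀ t, ((G (p x), t) ∈ D' ↔ (p x, t) ∈ D) ∧
        ((p x, t) ∈ D → R' (G (p x)) t = R (p x) t ∧ Z' (G (p x)) t = Z (p x) t) := by
  set S := p '' revolve U with hS
  have hSo : IsOpen S := h.isOpen_image hr
  -- Here the image must be an interval: on separate components the values of `G` could overlap, and
  -- distinct isobaric surfaces would merge.
  have hmono : StrictMonoOn G S := by
    refine strictMonoOn_of_deriv_pos hconn.ordConnected.convex hGs.continuousOn fun c hc => ?_
    have hc' := interior_subset hc
    rw [(hG c hc').deriv]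
    have := hφ0 c hc'
    positivity
  obtain ⟨hIo, hIs⟩ := isOpen_image_and_contDiffOn_invFunOn hSo hGs hG
    (fun c hc => pow_ne_zero 2 (hφ0 c hc)) hmono.injOn
  set I := Function.invFunOn G S
  have hIG : ∀ c ∈ S, I (G c) = c := fun c hc => hmono.injOn.leftInvOn_invFunOn hc
  have hDS : ∀ c t, (c, t) ∈ D → c ∈ S := fun c t ht => by
    rw [hS, ← h.image_fst hr]; exact ⟨_, ht, rfl⟩
  -- The first condition is needed since `I` takes an arbitrary value off `G '' S`.
  let D' : Set (ℝ × ℝ) := {q | q.1 ∈ G '' S ∧ (I q.1, q.2) ∈ D}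
  have hD' : ∀ c ∈ S, ∀ t, (G c, t) ∈ D' ↔ (c, t) ∈ D := fun c hc t => by
    simp only [D', mem_ofPred_eq, hIG c hc, mem_image_of_mem G hc, true_and]
  have hIsm : ContDiffOn ℝ ∞ (fun q : ℝ × ℝ => (I q.1, q.2)) (Prod.fst ⁻¹' (G '' S)) :=
    (hIs.comp contDiffOn_fst fun q hq => hq).prodMk contDiffOn_snd
  have hsub : D' ⊆ Prod.fst ⁻¹' (G '' S) := fun q hq => hq.1
  have hgT : ∀ c' t, (c', t) ∈ D' → ∃ c, (c, t) ∈ D ∧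
      geomT (fun x => φ (p x) • u x) (fun c => R (I c)) (fun c => Z (I c)) c' t =
        φ c * geomT u R Z c t := by
    rintro _ t ⟨⟨c, hc, rfl⟩, ht⟩
    simp only [hIG c hc] at ht
    refine ⟨c, ht, ?_⟩
    rw [← h.geomT_smul φ ht]
    simp only [geomT, coordT, hIG c hc]
  refine ⟨D', fun c => R (I c), fun c => Z (I c), ⟨?_, ?_, ?_, ?_, ?_, ?_⟩, hgT, ?_⟩
  · exact h.flow.smul_comp (isOpen_revolve hU) hSo hφ hGs hG
  · exact h.axisymmetric.smul_comp φ G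
  · intro x hx
    have hxS : p x ∈ S := mem_image_of_mem p hx
    rw [(hasGradientAt_comp (hG _ hxS) (h.hasFDerivAt_pressure hU hx).differentiableAt).gradient]
    exact smul_ne_zero (pow_ne_zero 2 (hφ0 _ hxS)) (h.regular x hx)
  · rintro _ ⟨x, hx, rfl⟩
    have hxS : p x ∈ S := mem_image_of_mem p hx
    have : isobaric (revolve U) (fun x => G (p x)) (G (p x)) = isobaric (revolve U) p (p x) :=
      ext fun y => and_congr_right fun hy =>
        hmono.injOn.eq_iff (mem_image_of_mem p hy) hxS
    rw [this]
    exact h.connected _ hxS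
  · refine ⟨?_, ?_, ?_, ?_, ?_, ?_⟩
    · exact hIsm.continuousOn.isOpen_inter_preimage (hIo.preimage continuous_fst)
        h.generatrix.isOpen_domain
    · intro c'
      by_cases hc : c' ∈ G '' S
      · obtain ⟨c, hc, rfl⟩ := hc
        simp only [hD' c hc]
        exact h.generatrix.interval c
      · have : {t | (c', t) ∈ D'} = ∅ := eq_empty_of_forall_notMem fun t ht => hc ht.1
        rw [this]
        exact isPreconnected_empty
    · exact h.generatrix.smooth_R.comp (hIsm.mono hsub) fun q hq => hq.2
    · exact h.generatrix.smooth_Z.comp (hIsm.mono hsub) fun q hq => hq.2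
    · intro c'
      by_cases hc : c' ∈ G '' S
      · obtain ⟨c, hc, rfl⟩ := hc
        simp only [hD' c hc, hIG c hc]
        rw [h.generatrix.image_eq c]
        refine ext fun q => and_congr_right fun hq => ?_
        have hqS : p (cyl q.1 0 q.2) ∈ S :=
          mem_image_of_mem p ((cyl_mem_revolve (hr q hq).le 0).2 hq)
        exact (hmono.injOn.eq_iff hqS hc).symm
      · have : {t | (c', t) ∈ D'} = ∅ := eq_empty_of_forall_notMem fun t ht => hc ht.1
        rw [this, image_empty]
        refine (eq_empty_of_forall_notMem fun q hq => hc ?_).symm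
        rw [← hq.2]
        exact mem_image_of_mem G
          (mem_image_of_mem p ((cyl_mem_revolve (hr q hq.1).le 0).2 hq.1))
    · exact fun c' t ht => h.generatrix.unit_speed _ t ht.2
  · intro c' t ht
    obtain ⟨c, hc, he⟩ := hgT c' t ht
    rw [he]
    exact mul_ne_zero (hφ0 c (hDS c t hc)) (h.geomT_ne_zero c t hc)
  · intro x hx t
    have hxS : p x ∈ S := mem_image_of_mem p hx
    refine ⟨hD' _ hxS t, fun _ => ?_⟩
    simp only [hIG _ hxS, and_self]

end RegularAxisymmetricFlow

theorem theorem6p1 (U : Set (ℝ × ℝ)) (hU : IsOpen U) (hr : ∀ q ∈ U, 0 < q.1)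
    (u : EuclideanSpace ℝ (Fin 3) → EuclideanSpace ℝ (Fin 3))
    (p : EuclideanSpace ℝ (Fin 3) → ℝ) (D : Set (ℝ × ℝ)) (R Z : ℝ → ℝ → ℝ)
    (h : RegularAxisymmetricFlow U u p D R Z) :
    -- the representation `u = u^t ∂/∂t + u^θ ∂/∂θ`
    (∀ c t θ, (c, t) ∈ D →
      u (cyl (R c t) θ (Z c t)) =
        geomT u R Z c t • coordT R Z c t θ + geomTheta u R Z c t • coordTheta R Z c t θ) ∧
    -- the speed is a smooth positive function of the pressure
    (∃ d : ℝ → ℝ, ContDiffOn ℝ ∞ d (p '' revolve U) ∧ (∀ c ∈ p '' revolve U, 0 < d c) ∧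
      ∀ x ∈ revolve U, ‖u x‖ ^ 2 = d (p x)) ∧
    -- normalization by passing to an equivalent flow; when the pressure takes its values in an
    -- interval, the new flow, with the same generatrices labelled by the new pressure,
    -- satisfies all the hypotheses again
    (∃ (u' : EuclideanSpace ℝ (Fin 3) → EuclideanSpace ℝ (Fin 3))
        (p' : EuclideanSpace ℝ (Fin 3) → ℝ),
      EquivalentFlows (revolve U) u p u' p' ∧
      IsGavrilovFlow (revolve U) u' p' ∧ IsAxisymmetric (revolve U) u' p' ∧
      (∀ x ∈ revolve U, ‖u' x‖ ^ 2 = 1) ∧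
      (∀ c t, (c, t) ∈ D → 0 < geomT u' R Z c t) ∧
      (IsPreconnected (p '' revolve U) →
        ∃ (D' : Set (ℝ × ℝ)) (R' Z' : ℝ → ℝ → ℝ),
          RegularAxisymmetricFlow U u' p' D' R' Z' ∧
          (∀ c t, (c, t) ∈ D' → 0 < geomT u' R' Z' c t) ∧
          ∀ x ∈ revolve U, ∀ t, ((p' x, t) ∈ D' ↔ (p x, t) ∈ D) ∧
            ((p x, t) ∈ D → R' (p' x) t = R (p x) t ∧ Z' (p' x) t = Z (p x) t))) ∧
    -- the equations for a normalized flow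
    ((∀ x ∈ revolve U, ‖u x‖ ^ 2 = 1) → (∀ c t, (c, t) ∈ D → 0 < geomT u R Z c t) →
      ∃ α b : ℝ → ℝ,
        ContDiffOn ℝ ∞ α (p '' revolve U) ∧ ContDiffOn ℝ ∞ b (p '' revolve U) ∧
        (∀ c ∈ p '' revolve U, 0 < α c) ∧
        ∀ c t, (c, t) ∈ D →
          |b c| < R c t ∧
          deriv (R c) t ^ 2 + deriv (Z c) t ^ 2 = 1 ∧
          Real.sqrt (R c t ^ 2 - b c ^ 2) * |jacobianRZ R Z c t| = α c ^ 2 ∧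
          curvatureRZ R Z c t * R c t * (R c t ^ 2 - b c ^ 2) + b c ^ 2 * deriv (Z c) t =
            Real.sign (jacobianRZ R Z c t) *
              (R c t ^ 3 * Real.sqrt (R c t ^ 2 - b c ^ 2) / α c ^ 2) ∧
          geomT u R Z c t = Real.sqrt (R c t ^ 2 - b c ^ 2) / R c t ∧
          geomTheta u R Z c t = b c / R c t ^ 2) := by
  refine ⟨fun c t θ ht => h.velocity_eq hU hr ht θ, h.exists_speed hU hr, ?_,
    fun h1 hpos => h.normalized_equations hU hr h1 hpos⟩
  obtain ⟨d, hd, hd0, hdu⟩ := h.exists_speed hU hr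
  obtain ⟨s, hs, hsc⟩ := h.exists_orientation hr
  have hSo := h.isOpen_image hr
  -- Dividing by `√d` gives unit speed; the sign `s` makes `u^t` positive.
  let φ : ℝ → ℝ := fun c => s c / Real.sqrt (d c)
  have hφ : ContDiffOn ℝ ∞ φ (p '' revolve U) :=
    hs.div (hd.sqrt fun c hc => (hd0 c hc).ne') fun c hc => (Real.sqrt_pos.2 (hd0 c hc)).ne'
  have hmem : ∀ c t, (c, t) ∈ D → c ∈ p '' revolve U := fun c t ht => by
    rw [← h.image_fst hr]; exact ⟨_, ht, rfl⟩
  have hφv : ∀ c t, (c, t) ∈ D → 0 < φ c * geomT u R Z c t := fun c t ht => by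
    have hv := abs_pos.2 (h.geomT_ne_zero c t ht)
    have hdc := Real.sqrt_pos.2 (hd0 c (hmem c t ht))
    have : φ c * geomT u R Z c t = |geomT u R Z c t| / Real.sqrt (d c) := by
      simp only [φ, ← hsc c t ht]
      field_simp
      rw [sq_abs]
    rw [this]
    positivity
  have hφsq : ∀ c ∈ p '' revolve U, φ c ^ 2 = (d c)⁻¹ := by
    intro c hc
    have hc' := hc
    rw [← h.image_fst hr] at hc'
    obtain ⟨⟨c, t⟩, ht, rfl⟩ := hc'
    have hv := h.geomT_ne_zero c t ht
    simp only [φ, ← hsc c t ht, div_pow, sq_abs, Real.sq_sqrt (hd0 _ hc).le]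
    field_simp
  have hφ0 : ∀ c ∈ p '' revolve U, φ c ≠ 0 := fun c hc h0 => by
    have := hφsq c hc
    rw [h0, zero_pow two_ne_zero] at this
    exact (inv_pos.2 (hd0 c hc)).ne this
  obtain ⟨G, hGs, hG⟩ := exists_hasDerivAt_of_contDiffOn hSo (hφ.pow 2)
  refine ⟨fun x => φ (p x) • u x, fun x => G (p x), ⟨φ, hφ, hφ0, fun x hx => ⟨rfl, ?_⟩⟩,
    h.flow.smul_comp (isOpen_revolve hU) hSo hφ hGs hG, h.axisymmetric.smul_comp φ G, fun x hx => ?_,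
    fun c t ht => ?_, fun hconn => ?_⟩
  · exact (hasGradientAt_comp (hG _ (Set.mem_image_of_mem p hx))
      (h.hasFDerivAt_pressure hU hx).differentiableAt).gradient
  · have hc := Set.mem_image_of_mem p hx
    rw [norm_smul, mul_pow, hdu x hx, Real.norm_eq_abs, sq_abs, hφsq _ hc,
      inv_mul_cancel₀ (hd0 _ hc).ne']
  · rw [h.geomT_smul φ ht]
    exact hφv c t ht
  · obtain ⟨D', R', Z', h1, h2, h3⟩ := h.smul_comp hU hr hφ hφ0 hGs hG hconn
    refine ⟨D', R', Z', h1, fun c' t ht => ?_, h3⟩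
    obtain ⟨c, hc, he⟩ := h2 c' t ht
    rw [he]
    exact hφv c t hc
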